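/- Let $\mu_0,\mu_1$ be Borel probability measures on $\mathbb{R}$ that are absolutely continuous with respect to Lebesgue measure, let $C\subseteq\mathbb{R}^2$ be closed and let $\delta\in\mathbb{R}$. Let $\Pi(\mu_0,\mu_1)$ be the set of joint distributions $\pi$ of $(Y_0,Y_1)$ on $\mathbb{R}^2$ with marginals $\mu_0$ and $\mu_1$, and let $\Pi_C=\{\pi\in\Pi(\mu_0,\mu_1):\pi(C)=1\}$ be the set of those that satisfy the support restriction $\Pr((Y_0,Y_1)\in C)=1$. For $\pi\in\Pi_C$ write $F_\Delta(\delta)=\pi(\{y_1-y_0\le\delta\})$ and $F_\Delta(\delta^-)=\pi(\{y_1-y_0<\delta\})$. For a bi-infinite sequence $(A_k)_{k\in\mathbb{Z}}$ of subsets of $\mathbb{R}$ put $$A_k^C=\{y_1:\exists y_0\in A_k,\ y_1-y_0\ge\delta,\ (y_0,y_1)\in C\}\cup\{y_1:\exists y_0\in A_{k+1},\ y_1-y_0<\delta,\ (y_0,y_1)\in C\},$$ and, for $(B_k)_{k\in\mathbb{Z}}$, $$B_k^C=\{y_1:\exists y_0\in B_k,\ y_1-y_0\le\delta,\ (y_0,y_1)\in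 C\}\cup\{y_1:\exists y_0\in B_{k+1},\ y_1-y_0>\delta,\ (y_0,y_1)\in C\}.$$ Define $$F_\Delta^L(\delta)=\sup_{(A_k)}\sum_{k=-\infty}^{\infty}\max\{\mu_0(A_k)-\mu_1(A_k^C),0\},\qquad F_\Delta^U(\delta)=1-\sup_{(B_k)}\sum_{k=-\infty}^{\infty}\max\{\mu_0(B_k)-\mu_1(B_k^C),0\},$$ where the suprema, taken in $[0,\infty]$, run over all bi-infinite sequences of open sets with $A_{k+1}\subseteq A_k$, respectively $B_{k+1}\subseteq B_k$, for all $k\in\mathbb{Z}$. Then: 1. (Duality.) With the conventions $\infty\cdot 0=0$ and $\infty\cdot 1=\infty$, in $[-\infty,\infty]$, $$F_\Delta^L(\delta)=\inf_{\pi\in\Pi(\mu_0,\mu_1)}\int\bigl(\mathbf{1}\{y_1-y_0<\delta\}+\infty\cdot(1-\mathbf{1}_C(y_0,y_1))\bigr)\,d\pi,$$ $$F_\Delta^U(\delta)=1-\inf_{\pi\in\Pi(\mu_0,\mu_1)}\int\bigl(\mathbf{1}\{y_1-y_0>\delta\}+\infty\cdot(1-\mathbf{1}_C(y_0,y_1))\bigr)\,d\pi.$$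 2. (Bounds.) For every $\pi\in\Pi_C$, $F_\Delta^L(\delta)\le F_\Delta(\delta^-)\le F_\Delta(\delta)\le F_\Delta^U(\delta)$. 3. (Sharpness.) If $\Pi_C\neq\emptyset$, then $F_\Delta^L(\delta)$ is the minimum of $F_\Delta(\delta^-)=\Pr(Y_1-Y_0<\delta)$ over $\pi\in\Pi_C$, and $F_\Delta^U(\delta)$ is the maximum of $F_\Delta(\delta)=\Pr(Y_1-Y_0\le\delta)$ over $\pi\in\Pi_C$. If moreover $\pi(\{y_1-y_0=\delta\})=0$ for every $\pi\in\Pi_C$, then $F_\Delta^L(\delta)$ is also the minimum of $F_\Delta(\delta)$ over $\pi\in\Pi_C$. -/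

import Mathlib

open MeasureTheory
open scoped ENNReal

/-- Joint distributions of `(Y₀, Y₁)` on `ℝ × ℝ` with marginals `μ₀` and `μ₁`. -/
def couplings (μ₀ μ₁ : Measure ℝ) : Set (Measure (ℝ × ℝ)) :=
  {π | π.fst = μ₀ ∧ π.snd = μ₁}

/-- Joint distributions with marginals `μ₀`, `μ₁` that satisfy the support restriction
`Pr((Y₀, Y₁) ∈ C) = 1`. -/
def admissible (μ₀ μ₁ : Measure ℝ) (C : Set (ℝ × ℝ)) : Set (Measure (ℝ × ℝ)) :=
  {π | π ∈ couplings μ₀ μ₁ ∧ π C = 1}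

/-- `Pr(Y₁ - Y₀ ≤ δ)`: the distribution function of the treatment effect under `π`. -/
noncomputable def dte (π : Measure (ℝ × ℝ)) (δ : ℝ) : ℝ :=
  π.real {y | y.2 - y.1 ≤ δ}

/-- `Pr(Y₁ - Y₀ < δ)`: the left limit of the distribution function of the treatment effect. -/
noncomputable def dteLeft (π : Measure (ℝ × ℝ)) (δ : ℝ) : ℝ :=
  π.real {y | y.2 - y.1 < δ}

/-- The cost `1{y₁ - y₀ < δ} + ∞ · (1 - 1_C(y₀, y₁))`, with values in `{0, 1, ∞}`. -/
noncomputable def lowerCost (C : Set (ℝ × ℝ)) (δ : ℝ) (y : ℝ × ℝ) : ℝ≥0∞ :=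
  {z : ℝ × ℝ | z.2 - z.1 < δ}.indicator 1 y + ∞ * (1 - C.indicator 1 y)

/-- The cost `1{y₁ - y₀ > δ} + ∞ · (1 - 1_C(y₀, y₁))`, with values in `{0, 1, ∞}`. -/
noncomputable def upperCost (C : Set (ℝ × ℝ)) (δ : ℝ) (y : ℝ × ℝ) : ℝ≥0∞ :=
  {z : ℝ × ℝ | δ < z.2 - z.1}.indicator 1 y + ∞ * (1 - C.indicator 1 y)

/-- The value of the optimal transportation problem with cost `c`. -/
noncomputable def transportValue (μ₀ μ₁ : Measure ℝ) (c : ℝ × ℝ → ℝ≥0∞) : ℝ≥0∞ :=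
  ⨅ π ∈ couplings μ₀ μ₁, ∫⁻ y, c y ∂π

/-- Monotonically decreasing bi-infinite sequences of open subsets of `ℝ`. -/
def decreasingOpen : Set (ℤ → Set ℝ) :=
  {A | Antitone A ∧ ∀ k, IsOpen (A k)}

/-- The set `A_k^C` of the lower bound. -/
def lowerImage (C : Set (ℝ × ℝ)) (δ : ℝ) (A : ℤ → Set ℝ) (k : ℤ) : Set ℝ :=
  {y₁ | ∃ y₀ ∈ A k, y₁ - y₀ ≥ δ ∧ (y₀, y₁) ∈ C} ∪
    {y₁ | ∃ y₀ ∈ A (k + 1), y₁ - y₀ < δ ∧ (y₀, y₁) ∈ C}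

/-- The set `B_k^C` of the upper bound. -/
def upperImage (C : Set (ℝ × ℝ)) (δ : ℝ) (B : ℤ → Set ℝ) (k : ℤ) : Set ℝ :=
  {y₁ | ∃ y₀ ∈ B k, y₁ - y₀ ≤ δ ∧ (y₀, y₁) ∈ C} ∪
    {y₁ | ∃ y₀ ∈ B (k + 1), y₁ - y₀ > δ ∧ (y₀, y₁) ∈ C}

/-- `sup_{A_k} ∑_k max {μ₀(A_k) - μ₁(A_k^C), 0}`, as an element of `[0, ∞]`. -/
noncomputable def lowerDual (μ₀ μ₁ : Measure ℝ) (C : Set (ℝ × ℝ)) (δ : ℝ) : ℝ≥0∞ :=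
  ⨆ A ∈ decreasingOpen,
    ∑' k : ℤ, ENNReal.ofReal (max (μ₀.real (A k) - μ₁.real (lowerImage C δ A k)) 0)

/-- `sup_{B_k} ∑_k max {μ₀(B_k) - μ₁(B_k^C), 0}`, as an element of `[0, ∞]`. -/
noncomputable def upperDual (μ₀ μ₁ : Measure ℝ) (C : Set (ℝ × ℝ)) (δ : ℝ) : ℝ≥0∞ :=
  ⨆ B ∈ decreasingOpen,
    ∑' k : ℤ, ENNReal.ofReal (max (μ₀.real (B k) - μ₁.real (upperImage C δ B k)) 0)

/-- The lower bound `F_Δ^L(δ)`. -/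
noncomputable def dteLower (μ₀ μ₁ : Measure ℝ) (C : Set (ℝ × ℝ)) (δ : ℝ) : EReal :=
  (lowerDual μ₀ μ₁ C δ : EReal)

/-- The upper bound `F_Δ^U(δ)`. -/
noncomputable def dteUpper (μ₀ μ₁ : Measure ℝ) (C : Set (ℝ × ℝ)) (δ : ℝ) : EReal :=
  1 - (upperDual μ₀ μ₁ C δ : EReal)

/-!
Both bounds are values of transport problems with a cost `1_U + ∞ · (1 - 1_C)`, where `C` is closed
and `U` is open: `U = {y₁ - y₀ < δ}` for the lower bound and `U = {y₁ - y₀ > δ}` for the upper one.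
It suffices to show that the supremum over decreasing sequences of open sets (`dualValue`) is at
most `π U` for every joint distribution `π` concentrated on `C`, and that if it is finite, it is
attained by one such `π`. If it is infinite, the first fact leaves no such `π`, so both sides of the
duality are infinite.

The first fact (`dualValue_le_measure`) holds because `μ₀ (A k) - μ₁ (image of A k)` is at most the
`π`-mass of the pairs with `y₀ ∈ A k` whose `y₁` is not in the image. Almost all of these pairs lie
in `U` and have `y₀ ∉ A (k + 1)`, so that these events are disjoint for different `k`.

For the second fact, any pair of potentials with `φ(y₀) ≤ ψ(y₁) + 1_U` on `C` satisfies
`∫ φ dμ₀ ≤ ∫ ψ dμ₁ + dualValue` (`lintegral_le_lintegral_add_dualValue`). Since the cost takes only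
the values `0`, `1` and `∞`, the level sets `{φ > s + k}`, `k ∈ ℤ`, form a decreasing sequence whose
images lie in `{ψ > s + k}`; integrating over `s ∈ (0, 1]` gives the inequality by the layer cake
formula. On compact spaces such a bound yields the optimal coupling at once
(`exists_coupling_of_compactSpace`): the functional `(φ, ψ, t) ↦ ∫ φ + ∫ ψ + t D` is extended by the
M. Riesz extension theorem to a functional of `((φ, ψ, t), h)` that is nonnegative whenever `t ≥ 0`
and `φ(x) + ψ(y) + t · cost + h(x, y) ≥ 0`, and the Riesz–Markov–Kakutani theorem represents
its restriction to continuous `h` by a measure. The line is embedded into the compact space `EReal`,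
and the coupling found there is carried back, since its marginals do not charge `±∞`
(`exists_coupling_measure_le_dualValue`).
-/

/-! ### The dual value for an open cost region -/

/-- The set of all `y₁` that are joined to `A k` by a pair of `C` outside `U`, or to `A (k + 1)` by
a pair of `C` inside `U`. For `U = {y₁ - y₀ < δ}` and `U = {y₁ - y₀ > δ}` these are the sets of the
lower and of the upper bound. -/
def dualImage (C U : Set (ℝ × ℝ)) (A : ℤ → Set ℝ) (k : ℤ) : Set ℝ :=
  {y₁ | ∃ y₀ ∈ A k, (y₀, y₁) ∉ U ∧ (y₀, y₁) ∈ C} ∪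
    {y₁ | ∃ y₀ ∈ A (k + 1), (y₀, y₁) ∈ U ∧ (y₀, y₁) ∈ C}

/-- The dual value of the transport problem with cost `1_U + ∞ · (1 - 1_C)`. The positive part of
the difference of measures is the truncated subtraction of `ℝ≥0∞`. -/
noncomputable def dualValue (μ₀ μ₁ : Measure ℝ) (C U : Set (ℝ × ℝ)) : ℝ≥0∞ :=
  ⨆ A ∈ decreasingOpen, ∑' k : ℤ, (μ₀ (A k) - μ₁ (dualImage C U A k))

lemma ofReal_max_measureReal_sub {α β : Type*} [MeasurableSpace α] [MeasurableSpace β]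
    (μ : Measure α) (ν : Measure β) [IsFiniteMeasure μ] [IsFiniteMeasure ν]
    (s : Set α) (t : Set β) :
    ENNReal.ofReal (max (μ.real s - ν.real t) 0) = μ s - ν t := by
  rw [ENNReal.ofReal_max, ENNReal.ofReal_zero, max_eq_left zero_le,
    ENNReal.ofReal_sub _ measureReal_nonneg, ofReal_measureReal, ofReal_measureReal]

lemma lowerDual_eq_dualValue (μ₀ μ₁ : Measure ℝ) [IsFiniteMeasure μ₀] [IsFiniteMeasure μ₁]
    (C : Set (ℝ × ℝ)) (δ : ℝ) :
    lowerDual μ₀ μ₁ C δ = dualValue μ₀ μ₁ C {y | y.2 - y.1 < δ} := by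
  simp only [lowerDual, dualValue, ofReal_max_measureReal_sub, lowerImage, dualImage,
    Set.mem_ofPred_eq, not_lt, ge_iff_le]

lemma upperDual_eq_dualValue (μ₀ μ₁ : Measure ℝ) [IsFiniteMeasure μ₀] [IsFiniteMeasure μ₁]
    (C : Set (ℝ × ℝ)) (δ : ℝ) :
    upperDual μ₀ μ₁ C δ = dualValue μ₀ μ₁ C {y | δ < y.2 - y.1} := by
  simp only [upperDual, dualValue, ofReal_max_measureReal_sub, upperImage, dualImage,
    Set.mem_ofPred_eq, not_lt, gt_iff_lt]

/-! ### Weak duality -/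

/-- Up to a null set, the pairs with `y₀ ∈ A k` and `y₁` outside the image of `A k` lie in `U` and
have `y₀ ∉ A (k + 1)`. These sets are disjoint for different `k`, which bounds the sum by `π U`. -/
lemma dualValue_le_measure {μ₀ μ₁ : Measure ℝ} {C U : Set (ℝ × ℝ)} (hU : MeasurableSet U)
    {π : Measure (ℝ × ℝ)} (hπ : π ∈ couplings μ₀ μ₁) (hC : π Cᶜ = 0) :
    dualValue μ₀ μ₁ C U ≤ π U := by
  refine iSup₂_le fun A hA => ?_
  obtain ⟨hanti, hopen⟩ := hA
  let S : ℤ → Set (ℝ × ℝ) := fun k => Prod.fst ⁻¹' (A k \ A (k + 1)) ∩ U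
  have hS : ∀ k, MeasurableSet (S k) := fun k =>
    (measurable_fst ((hopen k).measurableSet.diff (hopen (k + 1)).measurableSet)).inter hU
  have hdisj : Pairwise (Function.onFun Disjoint S) := by
    refine (pairwise_disjoint_on S).2 fun m n hmn => Set.disjoint_left.2 fun z hz hz' => ?_
    exact hz.1.2 (hanti (Int.add_one_le_of_lt hmn) hz'.1.1)
  have hle : ∀ k, μ₀ (A k) - μ₁ (dualImage C U A k) ≤ π (S k) := by
    intro k
    rw [tsub_le_iff_right]
    have hsub : Prod.fst ⁻¹' A k ⊆ (S k ∪ Prod.snd ⁻¹' dualImage C U A k) ∪ Cᶜ := by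
      rintro ⟨a, b⟩ (ha : a ∈ A k)
      by_cases hc : (a, b) ∈ C
      · left
        by_cases hu : (a, b) ∈ U
        · by_cases ha' : a ∈ A (k + 1)
          · exact Or.inr (Or.inr ⟨a, ha', hu, hc⟩)
          · exact Or.inl ⟨⟨ha, ha'⟩, hu⟩
        · exact Or.inr (Or.inl ⟨a, ha, hu, hc⟩)
      · exact Or.inr hc
    calc μ₀ (A k) = π (Prod.fst ⁻¹' A k) := by
          rw [← hπ.1, Measure.fst_apply (hopen k).measurableSet]
      _ ≤ π (S k) + π (Prod.snd ⁻¹' dualImage C U A k) + π Cᶜ :=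
          (measure_mono hsub).trans <| (measure_union_le _ _).trans <|
            add_le_add_left (measure_union_le _ _) _
      _ ≤ π (S k) + μ₁ (dualImage C U A k) := by
          rw [hC, add_zero, ← hπ.2]
          gcongr
          -- The image need not be measurable for this inequality.
          exact Measure.le_map_apply measurable_snd.aemeasurable _
  calc ∑' k, (μ₀ (A k) - μ₁ (dualImage C U A k)) ≤ ∑' k, π (S k) := ENNReal.tsum_le_tsum hle
    _ = π (⋃ k, S k) := (measure_iUnion hdisj hS).symm
    _ ≤ π U := measure_mono (Set.iUnion_subset fun k => Set.inter_subset_right)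

/-! ### From potentials to decreasing sequences of open sets -/

lemma setLIntegral_Ioi_zero_eq_tsum {g : ℝ → ℝ≥0∞} (hg : Measurable g) :
    ∫⁻ t in Set.Ioi 0, g t = ∫⁻ s in Set.Ioc 0 1, ∑' n : ℕ, g (s + n) := by
  have hunion : Set.Ioi (0 : ℝ) = ⋃ n : ℕ, Set.Ioc (n : ℝ) (n + 1) := by
    ext t
    simp only [Set.mem_Ioi, Set.mem_iUnion, Set.mem_Ioc]
    refine ⟨fun ht => ⟨⌈t⌉₊ - 1, ?_⟩, fun ⟨n, hn, _⟩ => n.cast_nonneg.trans_lt hn⟩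
    have h1 : 1 ≤ ⌈t⌉₊ := Nat.ceil_pos.2 ht
    rw [Nat.cast_sub h1]
    have h2 := Nat.ceil_lt_add_one ht.le
    have h3 := Nat.le_ceil t
    push_cast
    constructor <;> linarith
  have hdisj : Pairwise (Function.onFun Disjoint fun n : ℕ => Set.Ioc (n : ℝ) (n + 1)) := by
    refine (pairwise_disjoint_on _).2 fun m n hmn => Set.disjoint_left.2 fun t ht ht' => ?_
    have : (m : ℝ) + 1 ≤ n := by exact_mod_cast hmn
    exact absurd ht'.1 (not_lt.2 (ht.2.trans this))
  rw [hunion, lintegral_iUnion (fun _ => measurableSet_Ioc) hdisj,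
    lintegral_tsum (f := fun (n : ℕ) s => g (s + n)) fun n =>
      (hg.comp (measurable_id.add_const (n : ℝ))).aemeasurable]
  refine tsum_congr fun n => ?_
  rw [← (measurePreserving_add_right volume (n : ℝ)).setLIntegral_comp_preimage
    measurableSet_Ioc hg]
  simp

/-- The layer cake formula, with the levels `t > 0` written as `s + n`, `s ∈ (0, 1]`. -/
lemma lintegral_ofReal_eq_lintegral_tsum_measure {μ : Measure ℝ} {f : ℝ → ℝ}
    (hf : Measurable f) (hf0 : ∀ x, 0 ≤ f x) :
    ∫⁻ x, ENNReal.ofReal (f x) ∂μ =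
      ∫⁻ s in Set.Ioc 0 1, ∑' n : ℕ, μ {x | s + n < f x} := by
  rw [lintegral_eq_lintegral_meas_lt μ (.of_forall hf0) hf.aemeasurable]
  refine setLIntegral_Ioi_zero_eq_tsum (g := fun t => μ {x | t < f x}) (Antitone.measurable ?_)
  exact fun a b hab => measure_mono fun x (hx : b < f x) => hab.trans_lt hx

/-- Every pair of nonnegative potentials is dominated by the dual value: for each `s ∈ (0, 1]` the
superlevel sets `{φ > s + k}` form an admissible sequence whose images lie in `{ψ > s + k}`. -/
lemma lintegral_le_lintegral_add_dualValue {μ₀ μ₁ : Measure ℝ} {C U : Set (ℝ × ℝ)} {φ ψ : ℝ → ℝ}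
    (hφ : Continuous φ) (hψ : Measurable ψ) (hφ0 : ∀ x, 0 ≤ φ x) (hψ0 : ∀ x, 0 ≤ ψ x)
    (h : ∀ z ∈ C, φ z.1 ≤ ψ z.2 + U.indicator 1 z) :
    ∫⁻ x, ENNReal.ofReal (φ x) ∂μ₀ ≤ ∫⁻ y, ENNReal.ofReal (ψ y) ∂μ₁ + dualValue μ₀ μ₁ C U := by
  have key : ∀ s : ℝ, ∑' n : ℕ, μ₀ {x | s + n < φ x} ≤
      ∑' n : ℕ, μ₁ {y | s + n < ψ y} + dualValue μ₀ μ₁ C U := by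
    intro s
    let A : ℤ → Set ℝ := fun k => {x | s + k < φ x}
    have hA : A ∈ decreasingOpen := by
      refine ⟨fun k l hkl x (hx : s + l < φ x) => ?_, fun k => isOpen_lt continuous_const hφ⟩
      have : (k : ℝ) ≤ l := by exact_mod_cast hkl
      exact lt_of_le_of_lt (by gcongr) hx
    have himage : ∀ k, dualImage C U A k ⊆ {y | s + k < ψ y} := by
      rintro k y (⟨x, hx, hxU, hxC⟩ | ⟨x, hx, hxU, hxC⟩)
      · have := h _ hxC
        rw [Set.indicator_of_notMem hxU, add_zero] at this
        exact lt_of_lt_of_le hx this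
      · have := h _ hxC
        rw [Set.indicator_of_mem hxU] at this
        have hx' : s + ((k + 1 : ℤ) : ℝ) < φ x := hx
        simp only [Pi.one_apply] at this
        push_cast at hx'
        change s + k < ψ y
        linarith
    calc ∑' n : ℕ, μ₀ {x | s + n < φ x}
        ≤ ∑' n : ℕ, (μ₁ {y | s + n < ψ y} +
            (μ₀ (A (n : ℤ)) - μ₁ (dualImage C U A (n : ℤ)))) := by
          refine ENNReal.tsum_le_tsum fun n => ?_
          have h1 : μ₁ (dualImage C U A (n : ℤ)) ≤ μ₁ {y | s + n < ψ y} :=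
            measure_mono (by simpa using himage n)
          have h2 : μ₀ {x | s + n < φ x} = μ₀ (A (n : ℤ)) := by simp [A]
          rw [h2]
          exact le_add_tsub.trans (add_le_add_left h1 _)
      _ = ∑' n : ℕ, μ₁ {y | s + n < ψ y} +
            ∑' n : ℕ, (μ₀ (A (n : ℤ)) - μ₁ (dualImage C U A (n : ℤ))) := ENNReal.tsum_add
      _ ≤ _ := by
          gcongr
          refine (ENNReal.tsum_comp_le_tsum_of_injective Nat.cast_injective
            (fun k : ℤ => μ₀ (A k) - μ₁ (dualImage C U A k))).trans ?_
          exact le_iSup₂_of_le A hA le_rfl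
  rw [lintegral_ofReal_eq_lintegral_tsum_measure hφ.measurable hφ0,
    lintegral_ofReal_eq_lintegral_tsum_measure hψ hψ0]
  refine (lintegral_mono key).trans ?_
  rw [lintegral_add_right _ measurable_const]
  simp

/-! ### Duality on compact spaces -/

lemma ContinuousMap.integrable_of_compactSpace {X : Type*} [TopologicalSpace X] [CompactSpace X]
    [MeasurableSpace X] [BorelSpace X] (f : C(X, ℝ)) (μ : Measure X) [IsFiniteMeasure μ] :
    Integrable f μ :=
  f.continuous.integrable_of_hasCompactSupport (HasCompactSupport.of_compactSpace f)

/-- The linear functional on `C(X) × C(Y) × ℝ` that integrates the potentials and multiplies the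
scalar by `D`. -/
noncomputable def potentialFunctional {X Y : Type*} [TopologicalSpace X] [CompactSpace X]
    [MeasurableSpace X] [BorelSpace X] [TopologicalSpace Y] [CompactSpace Y] [MeasurableSpace Y]
    [BorelSpace Y] (μ : Measure X) (ν : Measure Y) [IsFiniteMeasure μ] [IsFiniteMeasure ν]
    (D : ℝ) : (C(X, ℝ) × C(Y, ℝ) × ℝ) →ₗ[ℝ] ℝ where
  toFun p := ∫ x, p.1 x ∂μ + ∫ y, p.2.1 y ∂ν + p.2.2 * D
  map_add' p q := by
    have h1 := integral_add (p.1.integrable_of_compactSpace μ) (q.1.integrable_of_compactSpace μ)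
    have h2 := integral_add (p.2.1.integrable_of_compactSpace ν)
      (q.2.1.integrable_of_compactSpace ν)
    simp only [Prod.fst_add, Prod.snd_add, ContinuousMap.add_apply, h1, h2]
    ring
  map_smul' c p := by
    simp only [Prod.smul_fst, Prod.smul_snd, ContinuousMap.smul_apply, smul_eq_mul,
      integral_const_mul, RingHom.id_apply]
    ring

/-- The convex cone of all `((φ, ψ, t), h)` with `t ≥ 0` and `φ(x) + ψ(y) + t 1_U(x, y) + h(x, y)`
nonnegative on `G`. Restricting the inequality to `G` encodes an infinite cost outside `G`. -/
def potentialCone {X Y : Type*} [TopologicalSpace X] [TopologicalSpace Y] (G U : Set (X × Y)) :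
    PointedCone ℝ ((C(X, ℝ) × C(Y, ℝ) × ℝ) × C(X × Y, ℝ)) where
  carrier := {p | 0 ≤ p.1.2.2 ∧
    ∀ z ∈ G, 0 ≤ p.1.1 z.1 + p.1.2.1 z.2 + p.1.2.2 * U.indicator 1 z + p.2 z}
  zero_mem' := by simp
  add_mem' := by
    rintro p q ⟨hp, hp'⟩ ⟨hq, hq'⟩
    refine ⟨add_nonneg hp hq, fun z hz => ?_⟩
    have := add_nonneg (hp' z hz) (hq' z hz)
    simp only [Prod.fst_add, Prod.snd_add, ContinuousMap.add_apply]
    linarith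
  smul_mem' := by
    rintro ⟨c, hc⟩ p ⟨hp, hp'⟩
    refine ⟨mul_nonneg hc hp, fun z hz => ?_⟩
    have h1 := mul_nonneg hc (hp' z hz)
    have h2 : c * (p.1.1 z.1 + p.1.2.1 z.2 + p.1.2.2 * U.indicator 1 z + p.2 z) =
      c * p.1.1 z.1 + c * p.1.2.1 z.2 + c * p.1.2.2 * U.indicator 1 z + c * p.2 z := by ring
    rw [h2] at h1
    exact h1

section

variable {X Y : Type*} [TopologicalSpace X] [CompactSpace X] [MeasurableSpace X] [BorelSpace X]
  [TopologicalSpace Y] [CompactSpace Y] [MeasurableSpace Y] [BorelSpace Y]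

/-- Extension of the potential functional to a positive functional that also sees functions of two
variables. The scalar coordinate stands for multiples of the cost, so that the extension assigns
the cost the value `D`. -/
lemma exists_nonneg_extension (μ : Measure X) (ν : Measure Y) [IsFiniteMeasure μ]
    [IsFiniteMeasure ν] {G U : Set (X × Y)} {D : ℝ} (hD : 0 ≤ D)
    (H : ∀ (φ : C(X, ℝ)) (ψ : C(Y, ℝ)), (∀ z ∈ G, 0 ≤ φ z.1 + ψ z.2 + U.indicator 1 z) →
      0 ≤ ∫ x, φ x ∂μ + ∫ y, ψ y ∂ν + D) :
    ∃ g : ((C(X, ℝ) × C(Y, ℝ) × ℝ) × C(X × Y, ℝ)) →ₗ[ℝ] ℝ,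
      (∀ p, g (p, 0) = potentialFunctional μ ν D p) ∧ ∀ p ∈ potentialCone G U, 0 ≤ g p := by
  let f : ((C(X, ℝ) × C(Y, ℝ) × ℝ) × C(X × Y, ℝ)) →ₗ.[ℝ] ℝ :=
    { domain := LinearMap.ker (LinearMap.snd ℝ (C(X, ℝ) × C(Y, ℝ) × ℝ) C(X × Y, ℝ))
      toFun := (potentialFunctional μ ν D ∘ₗ LinearMap.fst ℝ _ _) ∘ₗ Submodule.subtype _ }
  have scale : ∀ (φ : C(X, ℝ)) (ψ : C(Y, ℝ)) (t : ℝ), 0 < t →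
      (∀ z ∈ G, 0 ≤ φ z.1 + ψ z.2 + t * U.indicator 1 z) →
      0 ≤ ∫ x, φ x ∂μ + ∫ y, ψ y ∂ν + t * D := by
    intro φ ψ t ht h
    have h1 := H (t⁻¹ • φ) (t⁻¹ • ψ) fun z hz => by
      have h2 := mul_nonneg (inv_nonneg.2 ht.le) (h z hz)
      have h3 : t⁻¹ * (φ z.1 + ψ z.2 + t * U.indicator 1 z) =
        t⁻¹ * φ z.1 + t⁻¹ * ψ z.2 + U.indicator 1 z := by field_simp
      rw [h3] at h2
      exact h2
    simp only [ContinuousMap.smul_apply, smul_eq_mul, integral_const_mul] at h1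
    have h4 := mul_nonneg ht.le h1
    have h5 : t * (t⁻¹ * ∫ x, φ x ∂μ + t⁻¹ * ∫ y, ψ y ∂ν + D) =
      ∫ x, φ x ∂μ + ∫ y, ψ y ∂ν + t * D := by field_simp
    rwa [h5] at h4
  have nonneg : ∀ x : f.domain, (x : _ × _) ∈ potentialCone G U → 0 ≤ f x := by
    rintro ⟨⟨⟨φ, ψ, t⟩, h⟩, hh⟩ ⟨ht, hp⟩
    obtain rfl : h = 0 := hh
    change 0 ≤ ∫ x, φ x ∂μ + ∫ y, ψ y ∂ν + t * D
    simp only [ContinuousMap.zero_apply, add_zero] at hp ht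
    rcases ht.eq_or_lt with rfl | ht
    -- For `t = 0` the potentials are admissible with every positive multiple of the cost.
    · rw [zero_mul]
      refine le_of_forall_pos_le_add fun ε hε => ?_
      have hpos : 0 < ε / (D + 1) := by positivity
      have h1 := scale φ ψ (ε / (D + 1)) hpos fun z hz => by
        have h2 := hp z hz
        have h3 : 0 ≤ U.indicator (1 : X × Y → ℝ) z :=
          Set.indicator_nonneg (fun _ _ => zero_le_one) z
        rw [zero_mul, add_zero] at h2
        positivity
      have h4 : ε / (D + 1) * D ≤ ε := by
        rw [div_mul_eq_mul_div, div_le_iff₀ (by positivity)]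
        nlinarith
      linarith
    · exact scale φ ψ t ht hp
  have dense : ∀ y, ∃ x : f.domain, (x : _ × _) + y ∈ potentialCone G U := by
    rintro ⟨⟨φ, ψ, t⟩, h⟩
    refine ⟨⟨((ContinuousMap.const X (‖φ‖ + ‖ψ‖ + ‖h‖), 0, |t|), 0), rfl⟩, ?_, fun z _ => ?_⟩
    · exact neg_le_iff_add_nonneg.1 (neg_le_abs t)
    · have h1 := neg_le_of_abs_le (φ.norm_coe_le_norm z.1)
      have h2 := neg_le_of_abs_le (ψ.norm_coe_le_norm z.2)
      have h3 := neg_le_of_abs_le (h.norm_coe_le_norm z)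
      have h4 : 0 ≤ (|t| + t) * U.indicator (1 : X × Y → ℝ) z :=
        mul_nonneg (neg_le_iff_add_nonneg.1 (neg_le_abs t))
          (Set.indicator_nonneg (fun _ _ => zero_le_one) z)
      simp only [Prod.mk_add_mk, ContinuousMap.add_apply, ContinuousMap.const_apply,
        ContinuousMap.zero_apply]
      linarith
  obtain ⟨g, hg, hgs⟩ := riesz_extension (potentialCone G U) f nonneg dense
  exact ⟨g, fun p => hg ⟨(p, 0), rfl⟩, hgs⟩

/-- On compact spaces, a bound `D` on all potentials below the cost `1_U + ∞ · 1_{Gᶜ}` gives a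
coupling concentrated on `G` with `π U ≤ D`. -/
theorem exists_coupling_of_compactSpace [T2Space X] [T2Space Y] [SecondCountableTopology X]
    [SecondCountableTopology Y] [HasOuterApproxClosed X] [HasOuterApproxClosed Y]
    (μ : Measure X) (ν : Measure Y) [IsFiniteMeasure μ] [IsFiniteMeasure ν]
    {G U : Set (X × Y)} (hG : IsClosed G) (hU : IsOpen U) {D : ℝ} (hD : 0 ≤ D)
    (H : ∀ (φ : C(X, ℝ)) (ψ : C(Y, ℝ)), (∀ z ∈ G, 0 ≤ φ z.1 + ψ z.2 + U.indicator 1 z) →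
      0 ≤ ∫ x, φ x ∂μ + ∫ y, ψ y ∂ν + D) :
    ∃ π : Measure (X × Y), π.fst = μ ∧ π.snd = ν ∧ π Gᶜ = 0 ∧ π U ≤ ENNReal.ofReal D := by
  obtain ⟨g, hg, hgs⟩ := exists_nonneg_extension μ ν hD H
  let Λ : CompactlySupportedContinuousMap (X × Y) ℝ →ₚ[ℝ] ℝ := PositiveLinearMap.mk₀
    { toFun := fun h => g (0, h.toContinuousMap)
      map_add' := fun h k => by
        rw [← map_add, Prod.mk_add_mk, add_zero]
        rfl
      map_smul' := fun c h => by
        rw [RingHom.id_apply, ← map_smul, Prod.smul_mk, smul_zero]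
        rfl }
    (fun h hh => hgs _ ⟨le_rfl, fun z _ => by simpa using hh z⟩)
  let π := RealRMK.rieszMeasure Λ
  have hint : ∀ h : C(X × Y, ℝ), ∫ z, h z ∂π = g (0, h) := fun h =>
    RealRMK.integral_rieszMeasure Λ (CompactlySupportedContinuousMap.continuousMapEquiv h)
  -- `(φ, ψ, 0)` and the function `φ(x) + ψ(y)` have the same value, since their difference and its
  -- negative both lie in the cone.
  have hsum : ∀ (φ : C(X, ℝ)) (ψ : C(Y, ℝ)) (h : C(X × Y, ℝ)), (∀ z, h z = φ z.1 + ψ z.2) →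
      g (0, h) = ∫ x, φ x ∂μ + ∫ y, ψ y ∂ν := by
    intro φ ψ h hh
    have e1 : g ((φ, ψ, 0), -h) = ∫ x, φ x ∂μ + ∫ y, ψ y ∂ν - g (0, h) := by
      have : (((φ, ψ, 0), -h) : (C(X, ℝ) × C(Y, ℝ) × ℝ) × C(X × Y, ℝ)) =
          ((φ, ψ, 0), 0) - (0, h) := by simp
      rw [this, map_sub, hg]
      simp [potentialFunctional]
    have h1 := hgs ((φ, ψ, 0), -h) ⟨le_rfl, fun z _ => by simp [hh]⟩
    have h2 := hgs (-((φ, ψ, 0), -h)) ⟨by simp, fun z _ => by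
      simp only [Prod.neg_mk, ContinuousMap.neg_apply, neg_neg, hh, neg_zero, zero_mul]
      linarith⟩
    rw [map_neg] at h2
    linarith
  -- A continuous function below the cost has integral at most `D`.
  have hcost : ∀ h : C(X × Y, ℝ), (∀ z ∈ G, h z ≤ U.indicator 1 z) → ∫ z, h z ∂π ≤ D := by
    intro h hh
    have e1 : g ((0, 0, 1), -h) = D - g (0, h) := by
      have : (((0, 0, 1), -h) : (C(X, ℝ) × C(Y, ℝ) × ℝ) × C(X × Y, ℝ)) =
          ((0, 0, 1), 0) - (0, h) := by simp
      rw [this, map_sub, hg]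
      simp [potentialFunctional]
    have h1 := hgs ((0, 0, 1), -h) ⟨zero_le_one, fun z hz => by simpa using hh z hz⟩
    rw [hint]
    linarith
  -- For a compact `K` inside an open `V`, a Urysohn function bounds `π K`.
  have hcompact : ∀ (V K : Set (X × Y)) (c : ℝ), IsOpen V → IsCompact K → K ⊆ V →
      (∀ h : C(X × Y, ℝ), (∀ z, 0 ≤ h z) → (∀ z, h z ≤ V.indicator 1 z) → ∫ z, h z ∂π ≤ c) →
      π K ≤ ENNReal.ofReal c := by
    intro V K c hV hK hKV hc
    obtain ⟨h, h0, h1, h01⟩ := exists_continuous_zero_one_of_isClosed hV.isClosed_compl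
      hK.isClosed (Set.disjoint_left.2 fun z hz hz' => hz (hKV hz'))
    have hle := RealRMK.rieszMeasure_le_of_eq_one Λ
      (f := CompactlySupportedContinuousMap.continuousMapEquiv h) (fun z => (h01 z).1) hK
      (fun z hz => h1 hz)
    refine hle.trans (ENNReal.ofReal_le_ofReal ((hint h).symm.trans_le
      (hc h (fun z => (h01 z).1) fun z => ?_)))
    by_cases hz : z ∈ V
    · simpa [hz] using (h01 z).2
    · simp [hz, h0 (show z ∈ Vᶜ from hz)]
  refine ⟨π, ?_, ?_, ?_, ?_⟩
  · refine ext_of_forall_integral_eq_of_IsFiniteMeasure fun f => ?_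
    rw [Measure.fst, integral_map measurable_fst.aemeasurable
      f.continuous.measurable.aestronglyMeasurable]
    have := hsum f.toContinuousMap 0 (f.toContinuousMap.comp ⟨Prod.fst, continuous_fst⟩)
      fun z => by simp
    rw [← hint] at this
    simpa using this
  · refine ext_of_forall_integral_eq_of_IsFiniteMeasure fun f => ?_
    rw [Measure.snd, integral_map measurable_snd.aemeasurable
      f.continuous.measurable.aestronglyMeasurable]
    have := hsum 0 f.toContinuousMap (f.toContinuousMap.comp ⟨Prod.snd, continuous_snd⟩)
      fun z => by simp
    rw [← hint] at this
    simpa using this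
  · rw [hG.isOpen_compl.measure_eq_iSup_isCompact π]
    simp only [ENNReal.iSup_eq_zero]
    intro K hKG hK
    have := hcompact Gᶜ K 0 hG.isOpen_compl hK hKG fun h h0 h1 => ?_
    · simpa using this
    -- Every multiple of `h` vanishes on `G` and hence has integral at most `D`.
    · by_contra! hpos
      obtain ⟨n, hn⟩ := exists_nat_gt (D / ∫ z, h z ∂π)
      have hn' := hcost ((n : ℝ) • h) fun z hz => by
        have hz0 : h z = 0 := le_antisymm ((h1 z).trans (by simp [hz])) (h0 z)
        simp only [ContinuousMap.smul_apply, hz0, smul_zero]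
        exact Set.indicator_nonneg (fun _ _ => zero_le_one) z
      simp only [ContinuousMap.smul_apply, smul_eq_mul, integral_const_mul] at hn'
      rw [div_lt_iff₀ hpos] at hn
      linarith
  · rw [hU.measure_eq_iSup_isCompact π]
    exact iSup₂_le fun K hKU => iSup_le fun hK =>
      hcompact U K D hU hK hKU fun h _ h1 => hcost h fun z _ => h1 z

end

/-! ### Strong duality on the line -/

/-- The bound on potentials on `EReal` that the compact duality theorem asks for. Adding a constant
makes both potentials nonnegative without changing the inequality. -/
lemma integral_add_integral_add_dualValue_nonneg {μ₀ μ₁ : Measure ℝ} [IsProbabilityMeasure μ₀]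
    [IsProbabilityMeasure μ₁] {C U : Set (ℝ × ℝ)} (hD : dualValue μ₀ μ₁ C U ≠ ∞)
    {φ ψ : ℝ → ℝ} (hφ : Continuous φ) (hψ : Continuous ψ) {M : ℝ} (hφM : ∀ x, |φ x| ≤ M)
    (hψM : ∀ y, |ψ y| ≤ M) (h : ∀ z ∈ C, 0 ≤ φ z.1 + ψ z.2 + U.indicator 1 z) :
    0 ≤ ∫ x, φ x ∂μ₀ + ∫ y, ψ y ∂μ₁ + (dualValue μ₀ μ₁ C U).toReal := by
  have hφi : Integrable φ μ₀ := .of_bound hφ.aestronglyMeasurable M (.of_forall hφM)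
  have hψi : Integrable ψ μ₁ := .of_bound hψ.aestronglyMeasurable M (.of_forall hψM)
  have hφ0 : ∀ x, 0 ≤ M - φ x := fun x => sub_nonneg.2 (le_of_abs_le (hφM x))
  have hψ0 : ∀ y, 0 ≤ M + ψ y := fun y => neg_le_iff_add_nonneg'.1 (neg_le_of_abs_le (hψM y))
  have key := lintegral_le_lintegral_add_dualValue (μ₀ := μ₀) (μ₁ := μ₁) (C := C) (U := U)
    (φ := fun x => M - φ x) (ψ := fun y => M + ψ y) (by fun_prop) (by fun_prop) hφ0 hψ0
    (fun z hz => by linarith [h z hz])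
  have hφi' : Integrable (fun x => M - φ x) μ₀ := (integrable_const M).sub hφi
  have hψi' : Integrable (fun y => M + ψ y) μ₁ := (integrable_const M).add hψi
  rw [← ofReal_integral_eq_lintegral_ofReal hφi' (.of_forall hφ0),
    ← ofReal_integral_eq_lintegral_ofReal hψi' (.of_forall hψ0),
    ← ENNReal.ofReal_toReal hD, ← ENNReal.ofReal_add (integral_nonneg hψ0) ENNReal.toReal_nonneg,
    ENNReal.ofReal_le_ofReal_iff (add_nonneg (integral_nonneg hψ0) ENNReal.toReal_nonneg),
    integral_sub (integrable_const M) hφi, integral_add (integrable_const M) hψi] at key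
  simp only [integral_const, probReal_univ, one_smul] at key
  linarith

/-- A finite dual value is attained by a coupling concentrated on `C`. The compact duality theorem
is applied on `EReal × EReal`, where all pairs with an infinite coordinate have cost `0`; the
marginals give these pairs no mass. -/
theorem exists_coupling_measure_le_dualValue (μ₀ μ₁ : Measure ℝ) [IsProbabilityMeasure μ₀]
    [IsProbabilityMeasure μ₁] {C U : Set (ℝ × ℝ)} (hC : IsClosed C) (hU : IsOpen U)
    (hD : dualValue μ₀ μ₁ C U ≠ ∞) :
    ∃ π ∈ couplings μ₀ μ₁, π Cᶜ = 0 ∧ π U ≤ dualValue μ₀ μ₁ C U := by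
  let e : ℝ × ℝ → EReal × EReal := Prod.map (↑) (↑)
  have he : Topology.IsOpenEmbedding e :=
    EReal.isOpenEmbedding_coe.prodMap EReal.isOpenEmbedding_coe
  have hcoe : Measurable (fun x : ℝ => (x : EReal)) := measurable_coe_real_ereal
  have : IsProbabilityMeasure (μ₀.map (fun x : ℝ => (x : EReal))) :=
    Measure.isProbabilityMeasure_map hcoe.aemeasurable
  have : IsProbabilityMeasure (μ₁.map (fun x : ℝ => (x : EReal))) :=
    Measure.isProbabilityMeasure_map hcoe.aemeasurable
  have hpot : ∀ φ ψ : C(EReal, ℝ),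
      (∀ z ∈ (e '' Cᶜ)ᶜ, 0 ≤ φ z.1 + ψ z.2 + (e '' U).indicator 1 z) →
      0 ≤ ∫ x, φ x ∂μ₀.map (fun x : ℝ => (x : EReal)) +
        ∫ y, ψ y ∂μ₁.map (fun x : ℝ => (x : EReal)) + (dualValue μ₀ μ₁ C U).toReal := by
    intro φ ψ h
    rw [integral_map hcoe.aemeasurable φ.continuous.measurable.aestronglyMeasurable,
      integral_map hcoe.aemeasurable ψ.continuous.measurable.aestronglyMeasurable]
    refine integral_add_integral_add_dualValue_nonneg hD (φ.continuous.comp continuous_coe_real_ereal)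
      (ψ.continuous.comp continuous_coe_real_ereal) (M := max ‖φ‖ ‖ψ‖)
      (fun x => (φ.norm_coe_le_norm _).trans (le_max_left _ _))
      (fun y => (ψ.norm_coe_le_norm _).trans (le_max_right _ _)) fun z hz => ?_
    have h1 := h (e z) fun ⟨w, hw, hwz⟩ => hw (he.injective hwz ▸ hz)
    have h2 : (e '' U).indicator (1 : EReal × EReal → ℝ) (e z) = U.indicator 1 z := by
      by_cases hzU : z ∈ U
      · simp [hzU, Set.mem_image_of_mem e hzU]
      · have : e z ∉ e '' U := fun ⟨w, hw, hwz⟩ => hzU (he.injective hwz ▸ hw)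
        simp [hzU, this]
    rwa [h2] at h1
  obtain ⟨ρ, hρ₀, hρ₁, hρG, hρU⟩ := exists_coupling_of_compactSpace
    (μ₀.map (fun x : ℝ => (x : EReal))) (μ₁.map (fun x : ℝ => (x : EReal)))
    (G := (e '' Cᶜ)ᶜ) (U := e '' U) (he.isOpenMap _ hC.isOpen_compl).isClosed_compl
    (he.isOpenMap _ hU) (D := (dualValue μ₀ μ₁ C U).toReal) ENNReal.toReal_nonneg hpot
  let r : EReal × EReal → ℝ × ℝ := Prod.map EReal.toReal EReal.toReal
  have hr : Measurable r := measurable_ereal_toReal.prodMap measurable_ereal_toReal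
  have hid : ∀ μ : Measure ℝ, (μ.map (fun x : ℝ => (x : EReal))).map EReal.toReal = μ := by
    intro μ
    rw [Measure.map_map measurable_ereal_toReal hcoe]
    exact Measure.map_id
  have hfin : ∀ μ : Measure ℝ,
      ∀ᵐ x ∂μ.map (fun x : ℝ => (x : EReal)), ((x.toReal : ℝ) : EReal) = x := by
    intro μ
    rw [EReal.isOpenEmbedding_coe.measurableEmbedding.ae_map_iff]
    simp
  -- `ρ` is concentrated on the image of `ℝ × ℝ`.
  have hae : ∀ᵐ z ∂ρ, e (r z) = z := by
    have h₀ := hfin μ₀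
    have h₁ := hfin μ₁
    rw [← hρ₀] at h₀
    rw [← hρ₁] at h₁
    filter_upwards [ae_of_ae_map measurable_fst.aemeasurable h₀,
      ae_of_ae_map measurable_snd.aemeasurable h₁] with z hz₀ hz₁
    exact Prod.ext hz₀ hz₁
  have hpre : ∀ S, MeasurableSet S → ρ.map r S ≤ ρ (e '' S) := by
    intro S hS
    rw [Measure.map_apply hr hS]
    refine measure_mono_ae ?_
    filter_upwards [hae] with z hz hzS
    exact ⟨r z, hzS, hz⟩
  refine ⟨ρ.map r, ⟨?_, ?_⟩, ?_, ?_⟩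
  · calc (ρ.map r).fst = ρ.fst.map EReal.toReal := by
          rw [Measure.fst, Measure.fst, Measure.map_map measurable_fst hr,
            Measure.map_map measurable_ereal_toReal measurable_fst]
          rfl
      _ = μ₀ := by rw [hρ₀, hid]
  · calc (ρ.map r).snd = ρ.snd.map EReal.toReal := by
          rw [Measure.snd, Measure.snd, Measure.map_map measurable_snd hr,
            Measure.map_map measurable_ereal_toReal measurable_snd]
          rfl
      _ = μ₁ := by rw [hρ₁, hid]
  · rw [compl_compl] at hρG
    exact le_antisymm ((hpre _ hC.measurableSet.compl).trans hρG.le) zero_le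
  · rw [ENNReal.ofReal_toReal hD] at hρU
    exact (hpre _ hU.measurableSet).trans hρU

/-! ### The transport value -/

lemma lintegral_indicator_add_top_mul {π : Measure (ℝ × ℝ)} {C U : Set (ℝ × ℝ)}
    (hC : MeasurableSet C) (hU : MeasurableSet U) :
    ∫⁻ y, (U.indicator 1 y + ∞ * (1 - C.indicator 1 y)) ∂π = π U + ∞ * π Cᶜ := by
  have h : ∀ y, (1 : ℝ≥0∞) - C.indicator 1 y = Cᶜ.indicator 1 y := fun y => by
    by_cases hy : y ∈ C <;> simp [hy]
  simp only [h]
  rw [lintegral_add_left (measurable_one.indicator hU),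
    lintegral_const_mul _ (measurable_one.indicator hC.compl), lintegral_indicator_one hU,
    lintegral_indicator_one hC.compl]

theorem transportValue_eq_dualValue (μ₀ μ₁ : Measure ℝ) [IsProbabilityMeasure μ₀]
    [IsProbabilityMeasure μ₁] {C U : Set (ℝ × ℝ)} (hC : IsClosed C) (hU : IsOpen U) :
    transportValue μ₀ μ₁ (fun y => U.indicator 1 y + ∞ * (1 - C.indicator 1 y)) =
      dualValue μ₀ μ₁ C U := by
  simp only [transportValue, lintegral_indicator_add_top_mul hC.measurableSet hU.measurableSet]
  refine le_antisymm ?_ (le_iInf₂ fun π hπ => ?_)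
  · by_cases hD : dualValue μ₀ μ₁ C U = ∞
    · rw [hD]
      exact le_top
    · obtain ⟨π, hπ, hπC, hπU⟩ := exists_coupling_measure_le_dualValue μ₀ μ₁ hC hU hD
      exact iInf₂_le_of_le π hπ (by simpa [hπC] using hπU)
  · by_cases hπC : π Cᶜ = 0
    · simpa [hπC] using dualValue_le_measure hU.measurableSet hπ hπC
    · simp [ENNReal.top_mul hπC]

/-! ### The bounds -/

lemma isProbabilityMeasure_of_mem_couplings {μ₀ μ₁ : Measure ℝ} [IsProbabilityMeasure μ₀]
    {π : Measure (ℝ × ℝ)} (hπ : π ∈ couplings μ₀ μ₁) : IsProbabilityMeasure π :=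
  ⟨by rw [← Measure.fst_univ, hπ.1, measure_univ]⟩

lemma mem_admissible_iff {μ₀ μ₁ : Measure ℝ} [IsProbabilityMeasure μ₀] {C : Set (ℝ × ℝ)}
    (hC : MeasurableSet C) {π : Measure (ℝ × ℝ)} :
    π ∈ admissible μ₀ μ₁ C ↔ π ∈ couplings μ₀ μ₁ ∧ π Cᶜ = 0 := by
  refine and_congr_right fun hπ => ?_
  have := isProbabilityMeasure_of_mem_couplings hπ
  exact (prob_compl_eq_zero_iff hC).symm

/-- The dual value is the minimum of `π U` over the admissible joint distributions. -/
theorem isLeast_dualValue {μ₀ μ₁ : Measure ℝ} [IsProbabilityMeasure μ₀] [IsProbabilityMeasure μ₁]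
    {C U : Set (ℝ × ℝ)} (hC : IsClosed C) (hU : IsOpen U) (hne : (admissible μ₀ μ₁ C).Nonempty) :
    IsLeast ((fun π => π U) '' admissible μ₀ μ₁ C) (dualValue μ₀ μ₁ C U) := by
  have hle : ∀ π ∈ admissible μ₀ μ₁ C, dualValue μ₀ μ₁ C U ≤ π U := fun π hπ =>
    dualValue_le_measure hU.measurableSet hπ.1 ((mem_admissible_iff hC.measurableSet).1 hπ).2
  obtain ⟨π₀, hπ₀⟩ := hne
  have := isProbabilityMeasure_of_mem_couplings hπ₀.1
  obtain ⟨π, hπ, hπC, hπU⟩ := exists_coupling_measure_le_dualValue μ₀ μ₁ hC hU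
    ((hle π₀ hπ₀).trans_lt (measure_lt_top π₀ U)).ne
  have hadm := (mem_admissible_iff hC.measurableSet).2 ⟨hπ, hπC⟩
  exact ⟨⟨π, hadm, hπU.antisymm (hle π hadm)⟩, Set.forall_mem_image.2 hle⟩

lemma coe_measureReal_eq_coe_measure {α : Type*} [MeasurableSpace α] (π : Measure α)
    [IsFiniteMeasure π] (s : Set α) : ((π.real s : ℝ) : EReal) = ((π s : ℝ≥0∞) : EReal) :=
  EReal.coe_ennreal_toReal (measure_ne_top π s)

lemma coe_dte_eq_one_sub (π : Measure (ℝ × ℝ)) [IsProbabilityMeasure π] (δ : ℝ) :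
    (dte π δ : EReal) = 1 - ((π {y | δ < y.2 - y.1} : ℝ≥0∞) : EReal) := by
  have hm : MeasurableSet {y : ℝ × ℝ | δ < y.2 - y.1} :=
    measurableSet_lt measurable_const (measurable_snd.sub measurable_fst)
  have h : {y : ℝ × ℝ | y.2 - y.1 ≤ δ} = {y | δ < y.2 - y.1}ᶜ := by
    ext y
    simp
  rw [dte, h, probReal_compl_eq_one_sub hm, ← coe_measureReal_eq_coe_measure]
  rfl

theorem theorem1 (μ₀ μ₁ : Measure ℝ) [IsProbabilityMeasure μ₀] [IsProbabilityMeasure μ₁]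
    (hμ₀ : μ₀ ≪ volume) (hμ₁ : μ₁ ≪ volume)
    (C : Set (ℝ × ℝ)) (hC : IsClosed C) (δ : ℝ) :
    -- dual representation of the two optimal transportation problems
    (transportValue μ₀ μ₁ (lowerCost C δ) = lowerDual μ₀ μ₁ C δ ∧
      transportValue μ₀ μ₁ (upperCost C δ) = upperDual μ₀ μ₁ C δ) ∧
    -- validity of the bounds
    (∀ π ∈ admissible μ₀ μ₁ C,
      dteLower μ₀ μ₁ C δ ≤ (dteLeft π δ : EReal) ∧
      dteLower μ₀ μ₁ C δ ≤ (dte π δ : EReal) ∧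
      (dte π δ : EReal) ≤ dteUpper μ₀ μ₁ C δ) ∧
    -- sharpness of the bounds
    ((admissible μ₀ μ₁ C).Nonempty →
      IsLeast ((fun π => (dteLeft π δ : EReal)) '' admissible μ₀ μ₁ C) (dteLower μ₀ μ₁ C δ) ∧
      IsGreatest ((fun π => (dte π δ : EReal)) '' admissible μ₀ μ₁ C) (dteUpper μ₀ μ₁ C δ) ∧
      ((∀ π ∈ admissible μ₀ μ₁ C, π {y | y.2 - y.1 = δ} = 0) →
        IsLeast ((fun π => (dte π δ : EReal)) '' admissible μ₀ μ₁ C)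
          (dteLower μ₀ μ₁ C δ))) := by
  have hUl : IsOpen {y : ℝ × ℝ | y.2 - y.1 < δ} :=
    isOpen_lt (continuous_snd.sub continuous_fst) continuous_const
  have hUu : IsOpen {y : ℝ × ℝ | δ < y.2 - y.1} :=
    isOpen_lt continuous_const (continuous_snd.sub continuous_fst)
  have hprob : ∀ π ∈ admissible μ₀ μ₁ C, IsProbabilityMeasure π := fun π hπ =>
    isProbabilityMeasure_of_mem_couplings hπ.1
  have hleft : ∀ π ∈ admissible μ₀ μ₁ C,
      (dteLeft π δ : EReal) = ((π {y | y.2 - y.1 < δ} : ℝ≥0∞) : EReal) := fun π hπ =>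
    have := hprob π hπ
    coe_measureReal_eq_coe_measure π _
  have hdte : ∀ π ∈ admissible μ₀ μ₁ C,
      (dte π δ : EReal) = 1 - ((π {y | δ < y.2 - y.1} : ℝ≥0∞) : EReal) := fun π hπ =>
    have := hprob π hπ
    coe_dte_eq_one_sub π δ
  have hlower : ∀ π ∈ admissible μ₀ μ₁ C, dteLower μ₀ μ₁ C δ ≤ (dteLeft π δ : EReal) := by
    intro π hπ
    rw [hleft π hπ, dteLower, lowerDual_eq_dualValue, EReal.coe_ennreal_le_coe_ennreal_iff]
    exact (isLeast_dualValue hC hUl ⟨π, hπ⟩).2 ⟨π, hπ, rfl⟩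
  have hmono : ∀ π ∈ admissible μ₀ μ₁ C, (dteLeft π δ : EReal) ≤ (dte π δ : EReal) := by
    intro π hπ
    have := hprob π hπ
    exact EReal.coe_le_coe_iff.2 (measureReal_mono fun y (hy : y.2 - y.1 < δ) => hy.le)
  have hupper : ∀ π ∈ admissible μ₀ μ₁ C, (dte π δ : EReal) ≤ dteUpper μ₀ μ₁ C δ := by
    intro π hπ
    rw [hdte π hπ, dteUpper, upperDual_eq_dualValue]
    refine EReal.sub_le_sub le_rfl (EReal.coe_ennreal_le_coe_ennreal_iff.2 ?_)
    exact (isLeast_dualValue hC hUu ⟨π, hπ⟩).2 ⟨π, hπ, rfl⟩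
  refine ⟨⟨?_, ?_⟩, fun π hπ => ⟨hlower π hπ, (hlower π hπ).trans (hmono π hπ), hupper π hπ⟩,
    fun hne => ?_⟩
  · exact (transportValue_eq_dualValue μ₀ μ₁ hC hUl).trans
      (lowerDual_eq_dualValue μ₀ μ₁ C δ).symm
  · exact (transportValue_eq_dualValue μ₀ μ₁ hC hUu).trans
      (upperDual_eq_dualValue μ₀ μ₁ C δ).symm
  obtain ⟨πl, hπl, hl⟩ := (isLeast_dualValue hC hUl hne).1
  obtain ⟨πu, hπu, hu⟩ := (isLeast_dualValue hC hUu hne).1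
  have hmin : (dteLeft πl δ : EReal) = dteLower μ₀ μ₁ C δ := by
    rw [hleft πl hπl, dteLower, lowerDual_eq_dualValue, ← hl]
  refine ⟨⟨⟨πl, hπl, hmin⟩, Set.forall_mem_image.2 hlower⟩, ⟨⟨πu, hπu, ?_⟩,
    Set.forall_mem_image.2 hupper⟩, fun hatom => ⟨⟨πl, hπl, ?_⟩,
    Set.forall_mem_image.2 fun π hπ => (hlower π hπ).trans (hmono π hπ)⟩⟩
  · beta_reduce
    rw [hdte πu hπu, dteUpper, upperDual_eq_dualValue, ← hu]
  · have hsplit : {y : ℝ × ℝ | y.2 - y.1 ≤ δ} =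
        {y | y.2 - y.1 < δ} ∪ {y | y.2 - y.1 = δ} := by
      ext y
      exact le_iff_lt_or_eq (a := y.2 - y.1) (b := δ)
    have hreal : dte πl δ = dteLeft πl δ := by
      rw [dte, dteLeft, hsplit, measureReal_def, measureReal_def,
        measure_congr (union_ae_eq_left_of_ae_eq_empty (ae_eq_empty.2 (hatom πl hπl)))]
    exact (congrArg Real.toEReal hreal).trans hmin
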